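/- Let $F$ be a non-archimedean local field whose residue field has odd cardinality $q$, let $n\ge 1$, and put $I=\{1,\dots,n\}$. Then $$\sum_{\substack{\sigma\in\mathfrak S_n\\ \sigma^2=1}}(1-q^{-1})^{n-c_2(\sigma)}q^{-c_2(\sigma)}\sum_{I=I_0\cup\cdots\cup I_r}q^{-\tau(\{I_i\})-t(\sigma,\{I_i\})}\,\frac{q^{n(n+1)/2}}{\prod_{l=0}^r\left(q^{n(l)}-1\right)}=1.$$ Here the inner sum runs over all $r\ge 0$ and all ordered partitions $(I_0,\dots,I_r)$ of $I$ into non-empty, pairwise disjoint, $\sigma$-stable subsets, and $$c_2(\sigma)=\tfrac12\#\{i\in I\mid\sigma(i)\ne i\},\qquad \tau(\{I_i\})=\sum_{l=1}^r\#\{(i,j)\in I_l\times(I_0\cup\cdots\cup I_{l-1})\mid j<i\},$$ $$t(\sigma,\{I_i\})=\sum_{l=0}^r\#\{(i,j)\in I_l\times I_l\mid i<j<\sigma(i),\ \sigma(j)<\sigma(i)\},$$ $$n^{(l)}=\#I_l+\#I_{l+1}+\cdots+\#I_r,\qquad n(l)=\frac{n^{(l)}(n^{(l)}+1)}{2}\qquad(0\le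 l\le r).$$ -/

import Mathlib

open scoped ValuativeRel

namespace SiegelIdentity

/-- `I 0, …, I r` is an ordered partition of `{1, …, n}` (modelled by `Fin n`) into non-empty,
pairwise disjoint, `σ`-stable subsets. -/
def IsStablePartition {n r : ℕ} (σ : Equiv.Perm (Fin n)) (I : Fin (r + 1) → Finset (Fin n)) :
    Prop :=
  (∀ l, (I l).Nonempty) ∧
  (∀ l m, l ≠ m → Disjoint (I l) (I m)) ∧
  (∀ i, ∃ l, i ∈ I l) ∧
  (∀ l, ∀ i ∈ I l, σ i ∈ I l)

instance {n r : ℕ} (σ : Equiv.Perm (Fin n)) (I : Fin (r + 1) → Finset (Fin n)) :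
    Decidable (IsStablePartition σ I) := by
  unfold IsStablePartition; infer_instance

/-- All ordered partitions of `Fin n` into `r + 1` non-empty `σ`-stable blocks. -/
def stablePartitions {n : ℕ} (σ : Equiv.Perm (Fin n)) (r : ℕ) :
    Finset (Fin (r + 1) → Finset (Fin n)) :=
  Finset.univ.filter (IsStablePartition σ)

/-- All `σ ∈ 𝔖_n` with `σ² = 1`. -/
def involutions (n : ℕ) : Finset (Equiv.Perm (Fin n)) :=
  Finset.univ.filter (fun σ => σ ^ 2 = 1)

/-- Half the number of points moved by `σ` (an even number when `σ² = 1`). -/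
def c₂ {n : ℕ} (σ : Equiv.Perm (Fin n)) : ℕ :=
  (Finset.univ.filter (fun i => σ i ≠ i)).card / 2

/-- `∑_l #{(i, j) ∈ I_l × (I_0 ∪ ⋯ ∪ I_{l-1}) | j < i}`; the term `l = 0` is zero. -/
def tau {n r : ℕ} (I : Fin (r + 1) → Finset (Fin n)) : ℕ :=
  ∑ l, ((I l ×ˢ (Finset.univ.filter (fun m => m < l)).biUnion I).filter
    (fun p => p.2 < p.1)).card

/-- `∑_l #{(i, j) ∈ I_l × I_l | i < j < σ(i), σ(j) < σ(i)}`. -/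
def tInv {n r : ℕ} (σ : Equiv.Perm (Fin n)) (I : Fin (r + 1) → Finset (Fin n)) : ℕ :=
  ∑ l, ((I l ×ˢ I l).filter
    (fun p => p.1 < p.2 ∧ p.2 < σ p.1 ∧ σ p.2 < σ p.1)).card

/-- `n^{(l)} = #(I_l ∪ ⋯ ∪ I_r) = n_l + ⋯ + n_r`. -/
def nUpper {n r : ℕ} (I : Fin (r + 1) → Finset (Fin n)) (l : Fin (r + 1)) : ℕ :=
  ∑ m ∈ Finset.univ.filter (fun m => l ≤ m), (I m).card

/-- `n(l) = n^{(l)} (n^{(l)} + 1) / 2`. -/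
def nTri {n r : ℕ} (I : Fin (r + 1) → Finset (Fin n)) (l : Fin (r + 1)) : ℕ :=
  nUpper I l * (nUpper I l + 1) / 2

end SiegelIdentity

/-!
Put `p = 1 / q`. For a fixed ordered partition the sum over `σ` factors over the blocks, and the
factor of a block with `m` points is the proportion `a(m)` of invertible matrices among the
symmetric `m × m` matrices over `𝔽_q`: the largest point of the block is either fixed or paired
with another one, which is the recursion
`a(m + 1) = (1 - p) a(m) + p (1 - p ^ m) a(m - 1)`.

It remains to sum over ordered partitions. When the first block `A` is split off, the statistic `τ`
turns the sum over all `A` of a given size into a Gaussian binomial coefficient. The proportions of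
symmetric matrices of each rank add up to `1`, and this shows by induction that the sum over all
ordered partitions of a set with `m` points is `p ^ (m (m + 1) / 2)`.
-/

namespace SiegelIdentity

open Finset

section GaussBinom

variable {R : Type*} [CommRing R]

/-- The Gaussian binomial coefficient `[k + l choose k]_p`. Indexing by both parts, instead of by
`k + l` and `k`, avoids truncated subtraction. -/
def gaussBinom (p : R) : ℕ → ℕ → R
  | 0, _ => 1
  | _ + 1, 0 => 1
  | k + 1, l + 1 => gaussBinom p k (l + 1) + p ^ (k + 1) * gaussBinom p (k + 1) l

@[simp]
theorem gaussBinom_zero_left (p : R) (l : ℕ) : gaussBinom p 0 l = 1 := by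
  rw [gaussBinom]

@[simp]
theorem gaussBinom_zero_right (p : R) (k : ℕ) : gaussBinom p k 0 = 1 := by
  cases k <;> rw [gaussBinom]

theorem gaussBinom_succ_succ (p : R) (k l : ℕ) :
    gaussBinom p (k + 1) (l + 1) =
      gaussBinom p k (l + 1) + p ^ (k + 1) * gaussBinom p (k + 1) l := by
  rw [gaussBinom]

theorem one_sub_pow_mul_gaussBinom_succ (p : R) (k l : ℕ) :
    (1 - p ^ (k + 1)) * gaussBinom p (k + 1) l = (1 - p ^ (k + l + 1)) * gaussBinom p k l ∧
      (1 - p ^ (l + 1)) * gaussBinom p k (l + 1) = (1 - p ^ (k + l + 1)) * gaussBinom p k l := by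
  induction k generalizing l with
  | zero =>
    refine ⟨?_, by simp⟩
    induction l with
    | zero => simp
    | succ l ih =>
      rw [gaussBinom_succ_succ, mul_add, mul_left_comm, ih]
      simp only [gaussBinom_zero_left]
      ring
  | succ k ihk =>
    have right (l : ℕ) : (1 - p ^ (l + 1)) * gaussBinom p (k + 1) (l + 1) =
        (1 - p ^ (k + 1 + l + 1)) * gaussBinom p (k + 1) l := by
      rw [gaussBinom_succ_succ]
      linear_combination (ihk l).2 - (ihk l).1
    refine ⟨?_, right l⟩
    induction l with
    | zero => simp
    | succ l ihl =>
      rw [gaussBinom_succ_succ]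
      linear_combination p ^ (k + 2) * (ihl - right l)

theorem sum_antidiagonal_gaussBinom_succ (p : R) (n : ℕ) (f : ℕ → ℕ → R) :
    ∑ x ∈ antidiagonal (n + 1), gaussBinom p x.1 x.2 * f x.1 x.2 =
      ∑ x ∈ antidiagonal n,
        gaussBinom p x.1 x.2 * (p ^ x.1 * f x.1 (x.2 + 1) + f (x.1 + 1) x.2) := by
  simp only [mul_add, sum_add_distrib]
  rcases n with _ | n
  · simp [Nat.antidiagonal_succ]
  · rw [Nat.sum_antidiagonal_succ, Nat.sum_antidiagonal_succ' (n := n),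
      Nat.sum_antidiagonal_succ (n := n), Nat.sum_antidiagonal_succ' (n := n)]
    simp only [gaussBinom_succ_succ, gaussBinom_zero_left, gaussBinom_zero_right, add_mul,
      sum_add_distrib, pow_zero, one_mul, mul_assoc, mul_left_comm (p ^ _)]
    abel

theorem sum_antidiagonal_one_sub_pow_mul_gaussBinom (p : R) (n : ℕ) (f : ℕ → ℕ → R) :
    ∑ x ∈ antidiagonal (n + 1), gaussBinom p x.1 x.2 * ((1 - p ^ x.1) * f (x.1 - 1) x.2) =
      (1 - p ^ (n + 1)) * ∑ x ∈ antidiagonal n, gaussBinom p x.1 x.2 * f x.1 x.2 := by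
  rw [Nat.sum_antidiagonal_succ, mul_sum]
  simp only [pow_zero, sub_self, zero_mul, mul_zero, zero_add, Nat.add_sub_cancel]
  refine sum_congr rfl fun x hx => ?_
  rw [← mem_antidiagonal.mp hx, ← mul_assoc, ← mul_assoc,
    ← (one_sub_pow_mul_gaussBinom_succ p x.1 x.2).1, mul_comm (gaussBinom _ _ _)]

/-- For `p = q⁻¹`, the proportion of invertible matrices among the symmetric `n × n` matrices over
a field with `q` elements. -/
def symDensity (p : R) : ℕ → R
  | 0 => 1
  | 1 => 1 - p
  | n + 2 => (1 - p) * symDensity p (n + 1) + p * (1 - p ^ (n + 1)) * symDensity p n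

@[simp]
theorem symDensity_zero (p : R) : symDensity p 0 = 1 := by
  rw [symDensity]

theorem symDensity_succ (p : R) (n : ℕ) :
    symDensity p (n + 1) =
      (1 - p) * symDensity p n + p * (1 - p ^ n) * symDensity p (n - 1) := by
  rcases n with _ | n
  · simp [symDensity]
  · rw [symDensity, Nat.add_sub_cancel]

/-- For `p = q⁻¹` the summand at `(k, l)` is the proportion of matrices of rank `k` among the
symmetric `n × n` matrices over a field with `q` elements. -/
theorem sum_antidiagonal_gaussBinom_mul_symDensity (p : R) (n : ℕ) :
    ∑ x ∈ antidiagonal n,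
      gaussBinom p x.1 x.2 * (symDensity p x.1 * p ^ (x.2 + 1).choose 2) = 1 := by
  have recurrence (n : ℕ) :
      ∑ x ∈ antidiagonal (n + 1),
          gaussBinom p x.1 x.2 * (symDensity p x.1 * p ^ (x.2 + 1).choose 2) =
        (1 - p + p ^ (n + 1)) * ∑ x ∈ antidiagonal n,
          gaussBinom p x.1 x.2 * (symDensity p x.1 * p ^ (x.2 + 1).choose 2) +
        p * ∑ x ∈ antidiagonal n, gaussBinom p x.1 x.2 *
          ((1 - p ^ x.1) * (symDensity p (x.1 - 1) * p ^ (x.2 + 1).choose 2)) := by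
    rw [sum_antidiagonal_gaussBinom_succ p n fun k l => symDensity p k * p ^ (l + 1).choose 2,
      mul_sum, mul_sum, ← sum_add_distrib]
    refine sum_congr rfl fun x hx => ?_
    rw [symDensity_succ, ← mem_antidiagonal.mp hx, Nat.choose_succ_succ' (x.2 + 1) 1,
      Nat.choose_one_right]
    ring
  induction n using Nat.twoStepInduction with
  | zero => simp
  | one => simp [recurrence]
  | more n ih ih' =>
    rw [recurrence, sum_antidiagonal_one_sub_pow_mul_gaussBinom p n
      fun k l => symDensity p k * p ^ (l + 1).choose 2, ih, ih']
    ring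

end GaussBinom


section Crossings

variable {α : Type*} [LinearOrder α]

/-- The number of pairs `(i, j) ∈ J × A` with `j < i`. -/
def crossCount (J A : Finset α) : ℕ := ∑ i ∈ J, #{j ∈ A | j < i}

@[simp]
theorem crossCount_empty_right (J : Finset α) : crossCount J ∅ = 0 := by
  simp [crossCount]

theorem crossCount_union_right {A B : Finset α} (J : Finset α) (h : Disjoint A B) :
    crossCount J (A ∪ B) = crossCount J A + crossCount J B := by
  simp only [crossCount, filter_union, card_union_of_disjoint (disjoint_filter_filter h),
    sum_add_distrib]

theorem crossCount_biUnion_left {ι : Type*} [Fintype ι] {I : ι → Finset α}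
    (h : Pairwise (Function.onFun Disjoint I)) (A : Finset α) :
    crossCount (univ.biUnion I) A = ∑ l, crossCount (I l) A :=
  sum_biUnion fun _ _ _ _ hlm => h hlm

theorem crossCount_insert_left {J A : Finset α} {m : α} (hm : m ∉ J) (hA : ∀ x ∈ A, x < m) :
    crossCount (insert m J) A = #A + crossCount J A := by
  rw [crossCount, sum_insert hm, filter_true_of_mem hA, crossCount]

theorem crossCount_insert_right {J : Finset α} {m : α} (hJ : ∀ x ∈ J, x < m) (A : Finset α) :
    crossCount J (insert m A) = crossCount J A :=
  sum_congr rfl fun i hi => by rw [filter_insert, if_neg (hJ i hi).asymm]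

theorem sum_powerset_pow_crossCount {R : Type*} [CommRing R] (p : R) (S : Finset α)
    (f : ℕ → ℕ → R) :
    ∑ A ∈ S.powerset, p ^ crossCount (S \ A) A * f #A #(S \ A) =
      ∑ x ∈ antidiagonal #S, gaussBinom p x.1 x.2 * f x.1 x.2 := by
  induction S using Finset.induction_on_max generalizing f with
  | empty => simp
  | insert m S hm ih =>
    have hmS : m ∉ S := fun h => (hm m h).false
    rw [sum_powerset_insert hmS, card_insert_of_notMem hmS, sum_antidiagonal_gaussBinom_succ,
      ← ih fun k l => p ^ k * f k (l + 1) + f (k + 1) l, ← sum_add_distrib]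
    refine sum_congr rfl fun A hA => ?_
    have hAS : A ⊆ S := mem_powerset.mp hA
    have hmA : m ∉ A := fun h => hmS (hAS h)
    have hmSA : m ∉ S \ A := fun h => hmS (mem_sdiff.mp h).1
    rw [insert_sdiff_of_notMem _ hmA, insert_sdiff_insert, sdiff_insert_of_notMem hmS,
      crossCount_insert_left hmSA fun x hx => hm x (hAS hx),
      crossCount_insert_right fun x hx => hm x (mem_sdiff.mp hx).1,
      card_insert_of_notMem hmSA, card_insert_of_notMem hmA]
    ring

theorem sum_pow_card_filter_lt {R : Type*} [CommSemiring R] (p : R) (T : Finset α) :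
    ∑ a ∈ T, p ^ #{j ∈ T | a < j} = ∑ k ∈ range #T, p ^ k := by
  induction T using Finset.induction_on_max with
  | empty => simp
  | insert m T hm ih =>
    have hmT : m ∉ T := fun h => (hm m h).false
    have top : #{j ∈ insert m T | m < j} = 0 := by
      simpa [filter_eq_empty_iff] using fun x hx => (hm x hx).le
    rw [sum_insert hmT, top, card_insert_of_notMem hmT, geom_sum_succ, ← ih, mul_sum, pow_zero,
      add_comm]
    congr 1
    refine sum_congr rfl fun a ha => ?_
    rw [filter_insert, if_pos (hm a ha), card_insert_of_notMem (by simp [hmT]), pow_succ']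

end Crossings

section OrderedPartitions

variable {r : ℕ}

section Blocks

variable {α : Type*} [DecidableEq α]

/-- The ordered partitions of `S` into `r` non-empty blocks. -/
def orderedPartitions (r : ℕ) (S : Finset α) : Finset (Fin r → Finset α) :=
  {I ∈ Fintype.piFinset fun _ => S.powerset |
    (∀ l, (I l).Nonempty) ∧ (∀ l m, l ≠ m → Disjoint (I l) (I m)) ∧ univ.biUnion I = S}

theorem mem_orderedPartitions {S : Finset α} {I : Fin r → Finset α} :
    I ∈ orderedPartitions r S ↔
      (∀ l, (I l).Nonempty) ∧ Pairwise (Function.onFun Disjoint I) ∧ univ.biUnion I = S := by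
  simp only [orderedPartitions, mem_filter, Fintype.mem_piFinset, mem_powerset]
  refine and_iff_right_of_imp ?_
  rintro ⟨-, -, rfl⟩ l
  exact subset_biUnion_of_mem I (mem_univ l)

theorem biUnion_cons (A : Finset α) (I : Fin r → Finset α) :
    univ.biUnion (Fin.cons A I : Fin (r + 1) → Finset α) = A ∪ univ.biUnion I := by
  ext i
  simp [Fin.exists_fin_succ]

theorem pairwise_disjoint_cons {A : Finset α} {I : Fin r → Finset α} :
    Pairwise (Function.onFun Disjoint (Fin.cons A I : Fin (r + 1) → Finset α)) ↔
      Disjoint A (univ.biUnion I) ∧ Pairwise (Function.onFun Disjoint I) := by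
  simp only [Pairwise, Function.onFun, Fin.forall_fin_succ, Fin.cons_zero, Fin.cons_succ,
    disjoint_biUnion_right, mem_univ, true_imp_iff, ne_eq, Fin.succ_inj, Fin.succ_ne_zero,
    (Fin.succ_ne_zero _).symm, not_true_eq_false, not_false_eq_true, false_imp_iff, true_and,
    forall_and, disjoint_comm (b := A), ← and_assoc, and_self]

theorem cons_mem_orderedPartitions {S A : Finset α} {I : Fin r → Finset α} :
    (Fin.cons A I : Fin (r + 1) → Finset α) ∈ orderedPartitions (r + 1) S ↔
      (A ⊆ S ∧ A.Nonempty) ∧ I ∈ orderedPartitions r (S \ A) := by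
  have union_eq_iff {U : Finset α} : Disjoint A U ∧ A ∪ U = S ↔ A ⊆ S ∧ U = S \ A := by
    constructor
    · rintro ⟨hAU, rfl⟩
      exact ⟨subset_union_left, (union_sdiff_cancel_left hAU).symm⟩
    · rintro ⟨hAS, rfl⟩
      exact ⟨disjoint_sdiff, union_sdiff_of_subset hAS⟩
  simp only [mem_orderedPartitions, pairwise_disjoint_cons, biUnion_cons, Fin.forall_fin_succ,
    Fin.cons_zero, Fin.cons_succ]
  have := union_eq_iff (U := univ.biUnion I)
  tauto

theorem sum_orderedPartitions_succ {M : Type*} [AddCommMonoid M] (S : Finset α)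
    (f : (Fin (r + 1) → Finset α) → M) :
    ∑ I ∈ orderedPartitions (r + 1) S, f I =
      ∑ A ∈ S.powerset with A.Nonempty, ∑ I ∈ orderedPartitions r (S \ A), f (Fin.cons A I) := by
  rw [sum_sigma']
  refine sum_nbij' (fun I => ⟨I 0, Fin.tail I⟩) (fun x => Fin.cons x.1 x.2) ?_ ?_ ?_ ?_ ?_
  · intro I hI
    rw [← Fin.cons_self_tail I, cons_mem_orderedPartitions] at hI
    simpa using hI
  · rintro ⟨A, I⟩ hAI
    rw [cons_mem_orderedPartitions]
    simpa using hAI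
  · exact fun I _ => Fin.cons_self_tail I
  · exact fun x _ => by simp
  · exact fun I _ => by rw [Fin.cons_self_tail]

theorem exists_eq_fibers_of_mem_orderedPartitions [Fintype α] {I : Fin r → Finset α}
    (hI : I ∈ orderedPartitions r univ) :
    ∃ c : α → Fin r, I = fun l => ({i | c i = l} : Finset α) := by
  obtain ⟨-, hdisj, hunion⟩ := mem_orderedPartitions.mp hI
  have covered (i : α) : ∃ l, i ∈ I l := by
    have := mem_univ i
    rwa [← hunion, mem_biUnion, exists_congr fun _ => and_iff_right (mem_univ _)] at this
  choose c hc using covered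
  refine ⟨c, funext fun l => ext fun i => ?_⟩
  rw [mem_filter_univ]
  exact ⟨fun hi => hdisj.eq (not_disjoint_iff.mpr ⟨i, hc i, hi⟩), fun h => h ▸ hc i⟩

/-- The number of elements in block `l` and the later ones: the paper's `n^{(l)}` for blocks of an
arbitrary type. -/
def upperCard {α : Type*} (I : Fin r → Finset α) (l : Fin r) : ℕ := ∑ m with l ≤ m, #(I m)

theorem upperCard_zero {I : Fin (r + 1) → Finset α} (h : Pairwise (Function.onFun Disjoint I)) :
    upperCard I 0 = #(univ.biUnion I) := by
  rw [card_biUnion fun l _ m _ hlm => h hlm]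
  simp [upperCard]

theorem upperCard_cons_succ {α : Type*} (A : Finset α) (I : Fin r → Finset α) (l : Fin r) :
    upperCard (Fin.cons A I : Fin (r + 1) → Finset α) l.succ = upperCard I l := by
  simp [upperCard, sum_filter, Fin.sum_univ_succ]

end Blocks

variable {α : Type*} [LinearOrder α]

/-- The number of pairs `j < i` with `j` in an earlier block than `i`: the paper's `τ` for blocks
of an arbitrary linear order. -/
def crossings (I : Fin r → Finset α) : ℕ :=
  ∑ l, crossCount (I l) (({m | m < l} : Finset (Fin r)).biUnion I)

theorem crossings_cons {A : Finset α} {I : Fin r → Finset α} (hA : Disjoint A (univ.biUnion I))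
    (hI : Pairwise (Function.onFun Disjoint I)) :
    crossings (Fin.cons A I : Fin (r + 1) → Finset α) =
      crossCount (univ.biUnion I) A + crossings I := by
  have earlier (l : Fin r) :
      ({m | m < l.succ} : Finset (Fin (r + 1))).biUnion (Fin.cons A I : Fin (r + 1) → Finset α) =
        A ∪ ({m | m < l} : Finset (Fin r)).biUnion I := by
    ext i
    simp [Fin.exists_fin_succ]
  have disjoint_earlier (l : Fin r) : Disjoint A (({m | m < l} : Finset (Fin r)).biUnion I) :=
    hA.mono_right (biUnion_subset_biUnion_of_subset_left I (subset_univ _))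
  simp [crossings, Fin.sum_univ_succ, earlier, crossCount_union_right _ (disjoint_earlier _),
    sum_add_distrib, crossCount_biUnion_left hI]

section PartitionSum

variable {K : Type*} [Field K]

/-- What remains of the paper's sum over ordered partitions of `S` into `r` blocks, up to the
factor `q ^ (n (n + 1) / 2)`, after the summation over `σ`. -/
noncomputable def partitionSum (q : K) (r : ℕ) (S : Finset α) : K :=
  ∑ I ∈ orderedPartitions r S, q⁻¹ ^ crossings I *
    ∏ l, symDensity q⁻¹ #(I l) / (q ^ (upperCard I l + 1).choose 2 - 1)

@[simp]
theorem partitionSum_zero_empty (q : K) : partitionSum q 0 (∅ : Finset α) = 1 := by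
  have : orderedPartitions 0 (∅ : Finset α) = {Fin.elim0} := by
    ext I
    simp [mem_orderedPartitions, Pairwise, Subsingleton.elim I Fin.elim0]
  simp [partitionSum, this, crossings]

theorem partitionSum_zero_of_nonempty (q : K) {S : Finset α} (hS : S.Nonempty) :
    partitionSum q 0 S = 0 := by
  refine sum_eq_zero fun I hI => absurd (mem_orderedPartitions.mp hI).2.2 ?_
  simpa using hS.ne_empty.symm

theorem partitionSum_succ (q : K) (r : ℕ) (S : Finset α) :
    partitionSum q (r + 1) S = (∑ A ∈ S.powerset with A.Nonempty,
      q⁻¹ ^ crossCount (S \ A) A * (symDensity q⁻¹ #A * partitionSum q r (S \ A))) /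
        (q ^ (#S + 1).choose 2 - 1) := by
  simp only [partitionSum, sum_orderedPartitions_succ, mul_sum, sum_div]
  refine sum_congr rfl fun A hA => sum_congr rfl fun I hI => ?_
  have hcons := mem_orderedPartitions.mp
    (cons_mem_orderedPartitions.mpr ⟨by simpa using hA, hI⟩)
  obtain ⟨-, hpair, hunion⟩ := mem_orderedPartitions.mp hI
  rw [crossings_cons (pairwise_disjoint_cons.mp hcons.2.1).1 hpair, hunion, Fin.prod_univ_succ,
    upperCard_zero hcons.2.1, hcons.2.2, pow_add]
  simp only [Fin.cons_zero, Fin.cons_succ, upperCard_cons_succ]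
  ring

theorem sum_nonempty_pow_crossCount_mul_symDensity {R : Type*} [CommRing R] (p : R)
    (S : Finset α) :
    ∑ A ∈ S.powerset with A.Nonempty,
      p ^ crossCount (S \ A) A * (symDensity p #A * p ^ (#(S \ A) + 1).choose 2) =
        1 - p ^ (#S + 1).choose 2 := by
  have total := sum_powerset_pow_crossCount p S fun k l => symDensity p k * p ^ (l + 1).choose 2
  rw [sum_antidiagonal_gaussBinom_mul_symDensity,
    ← sum_filter_add_sum_filter_not _ Finset.Nonempty] at total
  rw [← total]
  simp [not_nonempty_iff_eq_empty, filter_eq']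

theorem sum_partitionSum {q : K} (hq₀ : q ≠ 0) (S : Finset α) {N : ℕ} (hN : #S < N)
    (hq : ∀ m, 0 < m → m ≤ #S → q ^ (m + 1).choose 2 ≠ 1) :
    ∑ r ∈ range N, partitionSum q r S = q⁻¹ ^ (#S + 1).choose 2 := by
  induction N generalizing S with
  | zero => omega
  | succ N ih =>
    rw [sum_range_succ']
    rcases S.eq_empty_or_nonempty with rfl | hS
    · simp [partitionSum_succ, filter_singleton]
    have peel : ∀ A ∈ S.powerset.filter Finset.Nonempty,
        ∑ r ∈ range N, partitionSum q r (S \ A) = q⁻¹ ^ (#(S \ A) + 1).choose 2 := by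
      intro A hA
      obtain ⟨hAS, hne⟩ : A ⊆ S ∧ A.Nonempty := by simpa using hA
      have hlt : #(S \ A) < #S := card_lt_card (sdiff_ssubset hAS hne)
      exact ih _ (by omega) fun m hm hmS => hq m hm (by omega)
    have denom_ne : q ^ (#S + 1).choose 2 - 1 ≠ 0 := sub_ne_zero.mpr (hq _ hS.card_pos le_rfl)
    simp only [partitionSum_succ, partitionSum_zero_of_nonempty q hS, add_zero, ← sum_div]
    rw [sum_comm, div_eq_iff denom_ne]
    simp only [← mul_sum]
    rw [sum_congr rfl fun A hA => by rw [peel A hA], sum_nonempty_pow_crossCount_mul_symDensity,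
      mul_sub, ← mul_pow, inv_mul_cancel₀ hq₀, one_pow, mul_one]

end PartitionSum

end OrderedPartitions

section ColorInvolutions

open Equiv Equiv.Perm

theorem disjoint_swap_of_apply_eq_self {α : Type*} [DecidableEq α] {σ : Perm α} {a m : α}
    (ha : σ a = a) (hm : σ m = m) : Perm.Disjoint (swap a m) σ := by
  intro x
  by_cases hxa : x = a
  · exact .inr (hxa ▸ ha)
  by_cases hxm : x = m
  · exact .inr (hxm ▸ hm)
  exact .inl (swap_apply_of_ne_of_ne hxa hxm)

theorem prod_card_filter_eq_mul_prod_erase {α ι M : Type*} [DecidableEq ι] [Fintype ι]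
    [CommMonoid M] {S T : Finset α} (c : α → ι) {b : ι}
    (h : ∀ l ≠ b, {i ∈ S | c i = l} = {i ∈ T | c i = l}) (f : ℕ → M) :
    ∏ l, f #{i ∈ S | c i = l} =
      f #{i ∈ S | c i = b} * ∏ l ∈ univ.erase b, f #{i ∈ T | c i = l} := by
  rw [← mul_prod_erase _ _ (mem_univ b)]
  congr 1
  exact prod_congr rfl fun l hl => by rw [h l (ne_of_mem_erase hl)]

variable {α ι : Type*} [Fintype α] [DecidableEq ι]

section Decomposition

variable [DecidableEq α] {S T : Finset α} {c : α → ι} {σ : Perm α} {a m : α}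

theorem apply_mem_of_support_subset (hσ : σ.support ⊆ S) {i : α} (hi : i ∈ S) : σ i ∈ S := by
  by_cases h : σ i = i
  · rwa [h]
  · exact hσ (apply_mem_support.mpr (mem_support.mpr h))

theorem apply_eq_self_of_support_subset (hσ : σ.support ⊆ S) {i : α} (hi : i ∉ S) : σ i = i :=
  notMem_support.mp fun h => hi (hσ h)

/-- The involutions supported on `S` that preserve the colouring `c`. For the colouring of the
points by the blocks of a partition, these are the involutions for which the blocks are stable. -/
def colorInvolutions (S : Finset α) (c : α → ι) : Finset (Perm α) :=
  {σ | σ ^ 2 = 1 ∧ σ.support ⊆ S ∧ ∀ i, c (σ i) = c i}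

theorem mem_colorInvolutions :
    σ ∈ colorInvolutions S c ↔ σ ^ 2 = 1 ∧ σ.support ⊆ S ∧ ∀ i, c (σ i) = c i := by
  simp [colorInvolutions]

theorem colorInvolutions_empty (c : α → ι) : colorInvolutions ∅ c = {1} := by
  ext σ
  simp only [mem_colorInvolutions, subset_empty, support_eq_empty_iff, mem_singleton]
  exact ⟨fun h => h.2.1, by rintro rfl; simp⟩

theorem filter_colorInvolutions_insert_apply_eq_self (c : α → ι) (hm : m ∉ T) :
    {σ ∈ colorInvolutions (insert m T) c | σ m = m} = colorInvolutions T c := by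
  ext σ
  simp only [mem_filter, mem_colorInvolutions]
  constructor
  · rintro ⟨⟨hsq, hsupp, hc⟩, hfix⟩
    exact ⟨hsq, (subset_insert_iff_of_notMem (notMem_support.mpr hfix)).mp hsupp, hc⟩
  · rintro ⟨hsq, hsupp, hc⟩
    exact ⟨⟨hsq, hsupp.trans (subset_insert m T), hc⟩, apply_eq_self_of_support_subset hsupp hm⟩

theorem swap_mul_mem_colorInvolutions_insert (hm : m ∉ T) (ha : a ∈ T) (hc : c a = c m) :
    swap a m * σ ∈ colorInvolutions (insert m T) c ∧ (swap a m * σ) m = a ↔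
      σ ∈ colorInvolutions (T.erase a) c := by
  have ham : a ≠ m := fun h => hm (h ▸ ha)
  have color_swap (x : α) : c (swap a m x) = c x := by
    rw [swap_apply_def]
    split_ifs with h h' <;> simp [*]
  have mem_iff (hσa : σ a = a) (hσm : σ m = m) :
      swap a m * σ ∈ colorInvolutions (insert m T) c ↔ σ ∈ colorInvolutions (T.erase a) c := by
    have hdisj := disjoint_swap_of_apply_eq_self hσa hσm
    have support_subset_iff :
        (swap a m * σ).support ⊆ insert m T ↔ σ.support ⊆ T.erase a := by
      rw [hdisj.support_mul, support_swap ham, union_subset_iff, subset_erase,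
        subset_insert_iff_of_notMem (notMem_support.mpr hσm)]
      simp [insert_subset_iff, ha, hσa]
    rw [mem_colorInvolutions, mem_colorInvolutions, hdisj.commute.mul_pow, sq (swap a m),
      swap_mul_self, one_mul, support_subset_iff]
    simp only [Perm.mul_apply, color_swap]
  constructor
  · rintro ⟨hτ, hτm⟩
    have hσm : σ m = m := (swap a m).injective (by simpa using hτm)
    have hσa : σ a = a := (swap a m).injective <| by
      have hτa := DFunLike.congr_fun (mem_colorInvolutions.mp hτ).1 m
      rw [sq, Perm.mul_apply, hτm] at hτa
      simpa using hτa
    exact (mem_iff hσa hσm).mp hτ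
  · intro hσ
    have hsupp := (mem_colorInvolutions.mp hσ).2.1
    have hσa : σ a = a := apply_eq_self_of_support_subset hsupp (by simp)
    have hσm : σ m = m := apply_eq_self_of_support_subset hsupp (by simp [hm])
    exact ⟨(mem_iff hσa hσm).mpr hσ, by simp [hσm]⟩

theorem sum_colorInvolutions_insert {M : Type*} [AddCommMonoid M] (c : α → ι) (hm : m ∉ T)
    (f : Perm α → M) :
    ∑ σ ∈ colorInvolutions (insert m T) c, f σ =
      ∑ σ ∈ colorInvolutions T c, f σ +
        ∑ a ∈ T with c a = c m, ∑ σ ∈ colorInvolutions (T.erase a) c, f (swap a m * σ) := by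
  have image_mem : ∀ σ ∈ colorInvolutions (insert m T) c,
      σ m ∈ insert m {a ∈ T | c a = c m} := by
    intro σ hσ
    obtain ⟨-, hsupp, hc⟩ := mem_colorInvolutions.mp hσ
    have := apply_mem_of_support_subset hsupp (mem_insert_self m T)
    simp_all
  rw [← sum_fiberwise_of_maps_to image_mem, sum_insert (by simp [hm]),
    filter_colorInvolutions_insert_apply_eq_self c hm]
  congr 1
  refine sum_congr rfl fun a ha => ?_
  obtain ⟨haT, hc⟩ := mem_filter.mp ha
  refine sum_nbij' (swap a m * ·) (swap a m * ·) ?_ ?_ ?_ ?_ ?_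
  · intro σ hσ
    rw [← swap_mul_mem_colorInvolutions_insert hm haT hc, swap_mul_self_mul]
    exact mem_filter.mp hσ
  · exact fun σ hσ => mem_filter.mpr ((swap_mul_mem_colorInvolutions_insert hm haT hc).mpr hσ)
  all_goals simp

end Decomposition

section Weight

variable [LinearOrder α] {T : Finset α} {σ : Perm α} {a m : α} {R : Type*} [CommRing R]

/-- The number of monochromatic pairs `(i, j)` in `S` with `i < j < σ i` and `σ j < σ i`. When `c`
colours the points by the blocks of a partition this is the paper's `t`. -/
def arcInversions (S : Finset α) (c : α → ι) (σ : Perm α) : ℕ :=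
  ∑ i ∈ S, #{j ∈ S | c j = c i ∧ i < j ∧ j < σ i ∧ σ j < σ i}

theorem arcInversions_insert_max (c : α → ι) (hm : ∀ x ∈ T, x < m) (hσ : σ.support ⊆ T) :
    arcInversions (insert m T) c σ = arcInversions T c σ := by
  have hmT : m ∉ T := fun h => (hm m h).false
  have hσm : σ m = m := apply_eq_self_of_support_subset hσ hmT
  have arc_m : #{j ∈ insert m T | c j = c m ∧ m < j ∧ j < σ m ∧ σ j < σ m} = 0 := by
    rw [card_eq_zero, filter_eq_empty_iff]
    rintro j - ⟨-, hmj, hjm, -⟩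
    exact (hmj.trans hjm).ne hσm.symm
  rw [arcInversions, sum_insert hmT, arc_m, zero_add]
  refine sum_congr rfl fun i hi => ?_
  have hσi : σ i < m := hm _ (apply_mem_of_support_subset hσ hi)
  rw [filter_insert, if_neg fun h => hσi.asymm h.2.2.1]

theorem arcInversions_swap_mul {c : α → ι} (hm : ∀ x ∈ T, x < m) (ha : a ∈ T) (hc : c a = c m)
    (hσ : σ.support ⊆ T.erase a) :
    arcInversions (insert m T) c (swap a m * σ) =
      #{j ∈ T | c j = c m ∧ a < j} + arcInversions (T.erase a) c σ := by
  have hmT : m ∉ T := fun h => (hm m h).false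
  have hσa : σ a = a := apply_eq_self_of_support_subset hσ (by simp)
  have hσm : σ m = m := apply_eq_self_of_support_subset hσ (by simp [hmT])
  have σ_mem {i : α} (hi : i ∈ T.erase a) : σ i ∈ T.erase a := apply_mem_of_support_subset hσ hi
  set τ := swap a m * σ with hτ
  have τa : τ a = m := by simp [hτ, hσa]
  have τm : τ m = a := by simp [hτ, hσm]
  have τ_eq {i : α} (hi : i ∈ T.erase a) : τ i = σ i :=
    swap_apply_of_ne_of_ne (mem_erase.mp (σ_mem hi)).1 (hm _ (mem_erase.mp (σ_mem hi)).2).ne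
  have σ_lt {i : α} (hi : i ∈ T.erase a) : σ i < m := hm _ (mem_erase.mp (σ_mem hi)).2
  have arc_m : #{j ∈ insert m T | c j = c m ∧ m < j ∧ j < τ m ∧ τ j < τ m} = 0 := by
    rw [card_eq_zero, filter_eq_empty_iff]
    rintro j - ⟨-, hmj, hja, -⟩
    exact (hmj.trans hja).asymm (τm ▸ hm a ha)
  have arc_a : {j ∈ insert m T | c j = c a ∧ a < j ∧ j < τ a ∧ τ j < τ a} =
      {j ∈ T | c j = c m ∧ a < j} := by
    rw [filter_insert, if_neg (by simp [τa])]
    refine filter_congr fun j hj => ?_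
    rw [τa, hc]
    refine and_congr_right fun _ => and_iff_left_of_imp fun haj => ?_
    have hj' : j ∈ T.erase a := mem_erase.mpr ⟨haj.ne', hj⟩
    exact ⟨hm j hj, τ_eq hj' ▸ σ_lt hj'⟩
  rw [arcInversions, sum_insert hmT, arc_m, zero_add, ← add_sum_erase _ _ ha, arc_a, arcInversions]
  congr 1
  refine sum_congr rfl fun i hi => ?_
  rw [← insert_erase ha, filter_insert, filter_insert, τ_eq hi,
    if_neg fun h => (σ_lt hi).asymm h.2.2.1, if_neg fun h => (σ_lt hi).asymm (τa ▸ h.2.2.2),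
    erase_insert (notMem_erase a T)]
  exact congrArg card (filter_congr fun j hj => by rw [τ_eq hj])

/-- The weight of `σ` in the paper's sum, for the points of `S` coloured by their blocks. -/
def involutionWeight (p : R) (S : Finset α) (c : α → ι) (σ : Perm α) : R :=
  (1 - p) ^ (#S - #σ.support / 2) * p ^ (#σ.support / 2 + arcInversions S c σ)

theorem involutionWeight_insert_max (p : R) (c : α → ι) (hm : ∀ x ∈ T, x < m)
    (hσ : σ.support ⊆ T) :
    involutionWeight p (insert m T) c σ = (1 - p) * involutionWeight p T c σ := by
  have hcard := card_le_card hσ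
  rw [involutionWeight, involutionWeight, arcInversions_insert_max c hm hσ,
    card_insert_of_notMem fun h => (hm m h).false,
    show #T + 1 - #σ.support / 2 = #T - #σ.support / 2 + 1 by omega]
  ring

theorem involutionWeight_swap_mul (p : R) {c : α → ι} (hm : ∀ x ∈ T, x < m) (ha : a ∈ T)
    (hc : c a = c m) (hσ : σ.support ⊆ T.erase a) :
    involutionWeight p (insert m T) c (swap a m * σ) =
      (1 - p) * p * p ^ #{j ∈ T | c j = c m ∧ a < j} * involutionWeight p (T.erase a) c σ := by
  have hmT : m ∉ T := fun h => (hm m h).false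
  have hdisj : Perm.Disjoint (swap a m) σ := disjoint_swap_of_apply_eq_self
    (apply_eq_self_of_support_subset hσ (by simp))
    (apply_eq_self_of_support_subset hσ (by simp [hmT]))
  have half_support : #(swap a m * σ).support / 2 = #σ.support / 2 + 1 := by
    rw [hdisj.card_support_mul, card_support_swap (hm a ha).ne]
    omega
  have hcard := card_le_card hσ
  rw [involutionWeight, involutionWeight, arcInversions_swap_mul hm ha hc hσ, half_support,
    card_insert_of_notMem hmT, ← card_erase_add_one ha,
    show #(T.erase a) + 1 + 1 - (#σ.support / 2 + 1) = #(T.erase a) - #σ.support / 2 + 1 by omega]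
  ring

theorem sum_involutionWeight_insert_max (p : R) (c : α → ι) (hm : ∀ x ∈ T, x < m) :
    ∑ σ ∈ colorInvolutions (insert m T) c, involutionWeight p (insert m T) c σ =
      (1 - p) * ∑ σ ∈ colorInvolutions T c, involutionWeight p T c σ +
        ∑ a ∈ T with c a = c m, (1 - p) * p * p ^ #{j ∈ T | c j = c m ∧ a < j} *
          ∑ σ ∈ colorInvolutions (T.erase a) c, involutionWeight p (T.erase a) c σ := by
  simp only [sum_colorInvolutions_insert c fun h => (hm m h).false, mul_sum]
  congr 1
  · exact sum_congr rfl fun σ hσ =>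
      involutionWeight_insert_max p c hm (mem_colorInvolutions.mp hσ).2.1
  · refine sum_congr rfl fun a ha => sum_congr rfl fun σ hσ => ?_
    obtain ⟨haT, hc⟩ := mem_filter.mp ha
    exact involutionWeight_swap_mul p hm haT hc (mem_colorInvolutions.mp hσ).2.1

theorem sum_involutionWeight [Fintype ι] (p : R) (S : Finset α) (c : α → ι) :
    ∑ σ ∈ colorInvolutions S c, involutionWeight p S c σ =
      ∏ l, symDensity p #{i ∈ S | c i = l} := by
  induction S using Finset.strongInduction with
  | H S ih =>
  rcases S.eq_empty_or_nonempty with rfl | hS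
  · simp [colorInvolutions_empty, involutionWeight, arcInversions]
  obtain ⟨m, T, hm, rfl⟩ : ∃ m T, (∀ x ∈ T, x < m) ∧ insert m T = S :=
    ⟨S.max' hS, S.erase (S.max' hS), fun x => S.lt_max'_of_mem_erase_max' hS,
      insert_erase (S.max'_mem hS)⟩
  have hmT : m ∉ T := fun h => (hm m h).false
  have hT : T ⊂ insert m T := ssubset_insert hmT
  set B := {i ∈ T | c i = c m} with hB
  set rest := ∏ l ∈ univ.erase (c m), symDensity p #{i ∈ T | c i = l}
  have prod_insert : ∏ l, symDensity p #{i ∈ insert m T | c i = l} =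
      symDensity p (#B + 1) * rest := by
    rw [prod_card_filter_eq_mul_prod_erase c (T := T) (b := c m)
      fun l hl => by rw [filter_insert, if_neg hl.symm], filter_insert, if_pos rfl,
      card_insert_of_notMem (by simp [hmT])]
  have prod_T : ∏ l, symDensity p #{i ∈ T | c i = l} = symDensity p #B * rest :=
    prod_card_filter_eq_mul_prod_erase c (fun _ _ => rfl) _
  have prod_erase : ∀ a ∈ B, ∏ l, symDensity p #{i ∈ T.erase a | c i = l} =
      symDensity p (#B - 1) * rest := by
    intro a ha
    have hc : c a = c m := (mem_filter.mp ha).2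
    rw [prod_card_filter_eq_mul_prod_erase c (T := T) (b := c m) fun l hl => by
      rw [filter_erase, erase_eq_of_notMem (by simp [hc, hl.symm])], filter_erase,
      card_erase_of_mem ha]
  have pair_term : ∀ a ∈ B, (1 - p) * p * p ^ #{j ∈ T | c j = c m ∧ a < j} *
      ∑ σ ∈ colorInvolutions (T.erase a) c, involutionWeight p (T.erase a) c σ =
        p ^ #{j ∈ B | a < j} * ((1 - p) * p * (symDensity p (#B - 1) * rest)) := by
    intro a ha
    rw [ih _ ((erase_subset a T).trans_ssubset hT), prod_erase a ha, hB, filter_filter]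
    ring
  rw [sum_involutionWeight_insert_max p c hm, ih T hT, prod_T, sum_congr rfl pair_term, ← sum_mul,
    sum_pow_card_filter_lt, prod_insert, symDensity_succ, ← mul_neg_geom_sum]
  ring

end Weight

end ColorInvolutions

section StablePartitions

theorem card_filter_product {α β : Type*} (s : Finset α) (t : Finset β) (P : α → β → Prop)
    [∀ i j, Decidable (P i j)] : #{x ∈ s ×ˢ t | P x.1 x.2} = ∑ i ∈ s, #{j ∈ t | P i j} := by
  simp only [card_filter, sum_product]

variable {n r : ℕ}

theorem tau_eq_crossings (I : Fin (r + 1) → Finset (Fin n)) : tau I = crossings I :=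
  sum_congr rfl fun _ _ => card_filter_product _ _ fun i j => j < i

theorem tInv_fibers (σ : Equiv.Perm (Fin n)) (c : Fin n → Fin (r + 1)) :
    tInv σ (fun l => {i | c i = l}) = arcInversions univ c σ := by
  rw [arcInversions, ← sum_fiberwise univ c]
  refine sum_congr rfl fun l _ => ?_
  rw [card_filter_product _ _ fun i j => i < j ∧ j < σ i ∧ σ j < σ i]
  refine sum_congr rfl fun i hi => ?_
  rw [filter_filter, (mem_filter.mp hi).2]

theorem succ_choose_two (m : ℕ) : (m + 1).choose 2 = m * (m + 1) / 2 := by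
  rw [Nat.choose_two_right, Nat.add_sub_cancel, mul_comm]

theorem nTri_eq_choose (I : Fin (r + 1) → Finset (Fin n)) (l : Fin (r + 1)) :
    nTri I l = (upperCard I l + 1).choose 2 :=
  (succ_choose_two _).symm

theorem stablePartitions_eq_filter (σ : Equiv.Perm (Fin n)) :
    stablePartitions σ r =
      {I ∈ orderedPartitions (r + 1) (univ : Finset (Fin n)) | ∀ l, ∀ i ∈ I l, σ i ∈ I l} := by
  ext I
  simp [stablePartitions, IsStablePartition, mem_orderedPartitions, Pairwise, Function.onFun,
    Finset.ext_iff, and_assoc]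

theorem involutionWeight_univ {R : Type*} [CommRing R] (p : R) (σ : Equiv.Perm (Fin n))
    (c : Fin n → Fin (r + 1)) :
    involutionWeight p univ c σ =
      (1 - p) ^ (n - c₂ σ) * p ^ (c₂ σ + tInv σ fun l => {i | c i = l}) := by
  rw [tInv_fibers, involutionWeight, card_fin]
  rfl

theorem sum_involutions_stabilizing {R : Type*} [CommRing R] (p : R)
    {I : Fin (r + 1) → Finset (Fin n)} (hI : I ∈ orderedPartitions (r + 1) univ) :
    ∑ σ ∈ involutions n with ∀ l, ∀ i ∈ I l, σ i ∈ I l,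
      (1 - p) ^ (n - c₂ σ) * p ^ (c₂ σ + tInv σ I) = ∏ l, symDensity p #(I l) := by
  obtain ⟨c, rfl⟩ := exists_eq_fibers_of_mem_orderedPartitions hI
  have stabilizing_eq : {σ ∈ involutions n | ∀ l, ∀ i ∈ ({i | c i = l} : Finset (Fin n)),
      σ i ∈ ({i | c i = l} : Finset (Fin n))} = colorInvolutions univ c := by
    ext σ
    simp [involutions, mem_colorInvolutions, forall_comm (α := Fin (r + 1))]
  rw [stabilizing_eq, ← sum_involutionWeight]
  exact sum_congr rfl fun σ _ => (involutionWeight_univ p σ c).symm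

theorem sum_involutions_sum_stablePartitions {K : Type*} [Field K] {q : K} (hq₀ : q ≠ 0)
    (n r : ℕ) :
    ∑ σ ∈ involutions n, (1 - q⁻¹) ^ (n - c₂ σ) * q ^ (-(c₂ σ : ℤ)) *
      ∑ I ∈ stablePartitions σ r, q ^ (-(tau I : ℤ) - (tInv σ I : ℤ)) *
        (q ^ (n * (n + 1) / 2) / ∏ l : Fin (r + 1), (q ^ nTri I l - 1)) =
      q ^ (n * (n + 1) / 2) * partitionSum q (r + 1) (univ : Finset (Fin n)) := by
  simp only [stablePartitions_eq_filter, sum_filter, mul_sum]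
  rw [sum_comm, partitionSum, mul_sum]
  refine sum_congr rfl fun I hI => ?_
  simp only [mul_ite, mul_zero]
  rw [← sum_filter, prod_div_distrib, ← sum_involutions_stabilizing q⁻¹ hI, sum_div, mul_sum,
    mul_sum]
  refine sum_congr rfl fun σ _ => ?_
  simp only [tau_eq_crossings, nTri_eq_choose, sub_eq_add_neg (-_ : ℤ), zpow_add₀ hq₀, zpow_neg,
    zpow_natCast, inv_pow, pow_add]
  ring

end StablePartitions

end SiegelIdentity

open Finset SiegelIdentity in
theorem proposition5p1_general {K : Type*} [Field K] {q : K} (hq₀ : q ≠ 0) {n : ℕ} (hn : 1 ≤ n)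
    (hq : ∀ m, 0 < m → m ≤ n → q ^ (m * (m + 1) / 2) ≠ 1) :
    ∑ σ ∈ involutions n, (1 - q⁻¹) ^ (n - c₂ σ) * q ^ (-(c₂ σ : ℤ)) *
      ∑ r ∈ range n, ∑ I ∈ stablePartitions σ r, q ^ (-(tau I : ℤ) - (tInv σ I : ℤ)) *
        (q ^ (n * (n + 1) / 2) / ∏ l : Fin (r + 1), (q ^ nTri I l - 1)) = 1 := by
  have total : ∑ r ∈ range n, partitionSum q (r + 1) (univ : Finset (Fin n)) =
      q⁻¹ ^ (n * (n + 1) / 2) := by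
    have univ_nonempty : (univ : Finset (Fin n)).Nonempty := card_pos.mp (by rwa [card_fin])
    have := sum_partitionSum hq₀ (univ : Finset (Fin n)) (N := n + 1) (by simp)
      fun m hm hmn => succ_choose_two m ▸ hq m hm (card_fin n ▸ hmn)
    rwa [sum_range_succ', partitionSum_zero_of_nonempty q univ_nonempty, add_zero, card_fin,
      succ_choose_two] at this
  simp only [mul_sum (range n)]
  rw [sum_comm, sum_congr rfl fun r _ => sum_involutions_sum_stablePartitions hq₀ n r, ← mul_sum,
    total, ← mul_pow, mul_inv_cancel₀ hq₀, one_pow]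

theorem proposition5p1 (F : Type*) [Field F] [ValuativeRel F] [TopologicalSpace F]
    [IsNonarchimedeanLocalField F] (q : ℕ) (hq : q = Nat.card 𝓀[F]) (hodd : Odd q)
    (n : ℕ) (hn : 1 ≤ n) :
    ∑ σ ∈ SiegelIdentity.involutions n,
      (1 - (q : ℝ)⁻¹) ^ (n - SiegelIdentity.c₂ σ) * (q : ℝ) ^ (-(SiegelIdentity.c₂ σ : ℤ)) *
        -- a partition of `n` points into `r + 1` non-empty blocks has `r < n`
        ∑ r ∈ Finset.range n, ∑ I ∈ SiegelIdentity.stablePartitions σ r,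
          (q : ℝ) ^ (-(SiegelIdentity.tau I : ℤ) - (SiegelIdentity.tInv σ I : ℤ)) *
            ((q : ℝ) ^ (n * (n + 1) / 2) /
              ∏ l : Fin (r + 1), ((q : ℝ) ^ SiegelIdentity.nTri I l - 1)) = 1 := by
  have one_lt_q : 1 < q := by
    rw [hq, Finite.one_lt_card_iff_nontrivial]
    infer_instance
  have one_lt_q' : (1 : ℝ) < q := by exact_mod_cast one_lt_q
  exact proposition5p1_general (by positivity) hn fun m hm _ =>
    (one_lt_pow₀ one_lt_q' (Nat.div_pos (by nlinarith) two_pos).ne').ne'
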